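/- Let $f\colon[0,1]\to[0,1]$ be an expanding Lorenz map, i.e. there is $c\in(0,1)$ such that $f$ is continuous and strictly increasing on $[0,c)$ and on $(c,1]$, $\lim_{x\to c^-}f(x)=1$, $\lim_{x\to c^+}f(x)=0$, and there is a finite set $F\subset[0,1]$ such that $f$ is differentiable at every point of $[0,1]\setminus F$ and $\inf_{x\notin F}f'(x)>1$. Let $\mathbb X$ be the set obtained from $[0,1]$ by replacing every point $a\in P:=\big(\bigcup_{n\ge0}f^{-n}(\{c\})\big)\setminus\{0,1\}$ by two points $a_-,a_+$. Let $\pi\colon\mathbb X\to[0,1]$ be the projection that glues $a_-$ and $a_+$ back together, order $\mathbb X$ linearly by $a_-<a_+$ for $a\in P$, and $x<y\iff\pi(x)<\pi(y)$ if $\pi(x)\ne\pi(y)$, and give $\mathbb X$ the order topology. Define the induced map $\hat f\colon\mathbb X\to\mathbb X$ by $\hat f(c_-)=1$, $\hat f(c_+)=0$; $\hat f(a_\pm)=f(a)_\pm$ for $a\in P\setminus\{c\}$; $\hat f(0)=f(0)_+$ if $f(0)\in P$ and $\hat f(1)=f(1)_-$ if $f(1)\in P$; and $\hat f(x)=f(x)$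 at all remaining points $x$. Suppose that $f$ is transitive, meaning that for any two nonempty open sets $U,V\subset\mathbb X$ there is an integer $n>0$ with $\hat f^{\,n}(U)\cap V\neq\emptyset$. Then $\hat f$ is strongly transitive: for every nonempty open set $U\subset\mathbb X$ there is an integer $k\ge0$ such that $$\bigcup_{i=0}^{k}\hat f^{\,i}(U)=\mathbb X .$$ -/

import Mathlib

open Set Topology

/-- An expanding Lorenz map `f : [0,1] → [0,1]` with critical point `c`. The map is carried by a
function on `ℝ`, of which only the values on `[0,1]` are ever used. The value at `c` is
unconstrained. -/
structure ExpandingLorenzMap where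
  /-- the map itself -/
  toFun : ℝ → ℝ
  /-- the critical point -/
  c : ℝ
  mapsTo : MapsTo toFun (Icc 0 1) (Icc 0 1)
  c_mem : c ∈ Ioo (0 : ℝ) 1
  continuousOn_left : ContinuousOn toFun (Ico 0 c)
  continuousOn_right : ContinuousOn toFun (Ioc c 1)
  strictMonoOn_left : StrictMonoOn toFun (Ico 0 c)
  strictMonoOn_right : StrictMonoOn toFun (Ioc c 1)
  tendsto_left : Filter.Tendsto toFun (𝓝[<] c) (𝓝 1)
  tendsto_right : Filter.Tendsto toFun (𝓝[>] c) (𝓝 0)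
  /-- off a finite set `f` is differentiable (at the endpoints: one-sidedly), with derivative
  bounded below by a constant larger than `1` -/
  expanding : ∃ F : Set ℝ, F.Finite ∧ F ⊆ Icc 0 1 ∧ ∃ r : ℝ, 1 < r ∧
    ∀ x ∈ Icc (0 : ℝ) 1 \ F, DifferentiableWithinAt ℝ toFun (Icc 0 1) x ∧
      r ≤ derivWithin toFun (Icc 0 1) x

namespace ExpandingLorenzMap

/-- The points that get doubled: `(⋃ n ≥ 0, f⁻ⁿ{c}) \ {0, 1}`. -/
def doubled (f : ExpandingLorenzMap) : Set ℝ :=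
  {x | x ∈ Icc (0 : ℝ) 1 ∧ ∃ n : ℕ, f.toFun^[n] x = f.c} \ {0, 1}

/-- The doubled-points space `𝕏`. A doubled point `a` gives the two points `a₋ = (a, false)` and
`a₊ = (a, true)`; every other `x ∈ [0,1]` gives the one point `(x, false)`. -/
def X (f : ExpandingLorenzMap) : Type :=
  {p : ℝ ×ₗ Bool // (ofLex p).1 ∈ Icc (0 : ℝ) 1 ∧ ((ofLex p).2 = true → (ofLex p).1 ∈ f.doubled)}

variable (f : ExpandingLorenzMap)

/-- The lexicographic order: `a₋ < a₊`, and points over distinct points of `[0,1]` are ordered as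
their projections. -/
noncomputable instance : LinearOrder f.X :=
  inferInstanceAs (LinearOrder {p : ℝ ×ₗ Bool // (ofLex p).1 ∈ Icc (0 : ℝ) 1 ∧
    ((ofLex p).2 = true → (ofLex p).1 ∈ f.doubled)})

/-- `𝕏` carries its order topology. -/
noncomputable instance : TopologicalSpace f.X := Preorder.topology f.X

instance : OrderTopology f.X := ⟨rfl⟩

variable {f}

/-- The natural projection `π : 𝕏 → [0,1]`. -/
def X.proj (p : f.X) : ℝ := (ofLex p.1).1

/-- `true` exactly at the points of the form `a₊`. -/
def X.side (p : f.X) : Bool := (ofLex p.1).2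

theorem X.proj_mem (p : f.X) : p.proj ∈ Icc (0 : ℝ) 1 := p.2.1

variable (f)

open Classical in
/-- For a doubled point `y` this is `y₋` if `s = false` and `y₊` if `s = true`; for any other `y` it
is the only point of `𝕏` over `y`. -/
noncomputable def ptOver (y : ℝ) (hy : y ∈ Icc (0 : ℝ) 1) (s : Bool) : f.X :=
  ⟨toLex (y, if y ∈ f.doubled then s else false), hy, fun h => by
    by_contra hn
    have hn' : y ∉ f.doubled := hn
    simp [hn'] at h⟩

open Classical in
/-- The map `f̂ : 𝕏 → 𝕏` induced by `f`: `c₋ ↦ 1` and `c₊ ↦ 0`; the endpoint `0` goes to the upper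
point over `f 0` (if `f 0` is doubled), the endpoint `1` (which has side `false`) to the lower point
over `f 1` (if `f 1` is doubled); `a₋ ↦ (f a)₋` and `a₊ ↦ (f a)₊` for a doubled `a ≠ c`; and `x` goes
to `f x` for every other `x`. -/
noncomputable def hat (p : f.X) : f.X :=
  if p.proj = f.c then
    if p.side = true then f.ptOver 0 (left_mem_Icc.2 zero_le_one) false
    else f.ptOver 1 (right_mem_Icc.2 zero_le_one) false
  else if p.proj = 0 then f.ptOver (f.toFun p.proj) (f.mapsTo p.proj_mem) true
  else f.ptOver (f.toFun p.proj) (f.mapsTo p.proj_mem) p.side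

end ExpandingLorenzMap

/-- Topological transitivity: for all nonempty open `U`, `V` some iterate `Tⁿ(U)`, `n > 0`, meets
`V`. -/
def IsTopTransitive {Y : Type*} [TopologicalSpace Y] (T : Y → Y) : Prop :=
  ∀ U V : Set Y, IsOpen U → U.Nonempty → IsOpen V → V.Nonempty →
    ∃ n : ℕ, 0 < n ∧ ((T^[n] '' U) ∩ V).Nonempty

/-- A Lorenz map is transitive if the induced map on the doubled-points space is. -/
def ExpandingLorenzMap.IsTransitive (f : ExpandingLorenzMap) : Prop :=
  IsTopTransitive f.hat

/-!
Every point of `[0, 1]` is doubled into two sided points `x₋`, `x₊`, and `f` is lifted to sided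
points through its one-sided limits. The space `𝕏` is a monotone quotient of the sided points
(`collapse`), the quotient map is a semiconjugacy (`hat_collapse`), and both transitivity and the
conclusion pass through it. The gain is that the lifted map is open (`isSidedOpen_image`), whereas
`f̂` may fail to be open at `0` and `1`.

Let `W` be the forward orbit of a nonempty open set of sided points. By expansion `W` contains a
neighbourhood of `c`, hence also intervals at `0` and `1`. Suppose that `W` misses some points.
The orbit of the neighbourhood of `c` runs through intervals contained in `W` whose lengths are
bounded below by some `ε`; by transitivity it visits the space between any two missed points, so
these are `ε`-separated (`exists_separated`). Therefore one can choose `η` so small that the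
one-sided `η`-neighbourhoods of the missed points form a set which the inverse branches map into
itself: these contract, they send missed points to missed points, and by the choice of `η` the
ends of their domains, at `f 0` and `f 1`, do not separate a missed point from a point of its
neighbourhood. Points near `c` then never enter this set, which contradicts transitivity
(`sided_subset_of_forward_invariant`). So `W` is everything, and finitely many iterates suffice
because `[0, 1]` is compact (`exists_iterate_cover`).
-/

namespace ExpandingLorenzMap

variable (f : ExpandingLorenzMap)

/-! ### Sided points -/

/-- The sided points `(x, b)` between `s` and `t`: those lying in `[s₊, t₋]`, where `(x, false)`
stands for `x₋` and `(x, true)` for `x₊`. All points are doubled here. -/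
def sided (s t : ℝ) : Set (ℝ × Bool) :=
  {d | s ≤ d.1 ∧ d.1 ≤ t ∧ (d.2 = true → d.1 < t) ∧ (d.2 = false → s < d.1)}

theorem mem_sided {s t x : ℝ} {b : Bool} : (x, b) ∈ sided s t ↔
    s ≤ x ∧ x ≤ t ∧ (b = true → x < t) ∧ (b = false → s < x) := Iff.rfl

theorem mem_sided_true {s t x : ℝ} : (x, true) ∈ sided s t ↔ s ≤ x ∧ x < t := by
  simp only [mem_sided]; grind

theorem mem_sided_false {s t x : ℝ} : (x, false) ∈ sided s t ↔ s < x ∧ x ≤ t := by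
  simp only [mem_sided]; grind

theorem mem_sided_of_lt {s t : ℝ} {d : ℝ × Bool} (h₁ : s < d.1) (h₂ : d.1 < t) : d ∈ sided s t :=
  ⟨h₁.le, h₂.le, fun _ => h₂, fun _ => h₁⟩

theorem sided_subset_sided {s t s' t' : ℝ} (hs : s' ≤ s) (ht : t ≤ t') :
    sided s t ⊆ sided s' t' := fun _ h =>
  ⟨hs.trans h.1, h.2.1.trans ht, fun hb => (h.2.2.1 hb).trans_le ht,
    fun hb => hs.trans_lt (h.2.2.2 hb)⟩

theorem mem_sided_or {s u : ℝ} {d : ℝ × Bool} (h : d ∈ sided s u) (t : ℝ) :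
    d ∈ sided s t ∨ d ∈ sided t u := by
  obtain ⟨x, b⟩ := d
  cases b <;> simp only [mem_sided_true, mem_sided_false] at h ⊢ <;> grind

theorem notMem_sided_of_mem {s t u : ℝ} {d : ℝ × Bool} (h : d ∈ sided t u) : d ∉ sided s t := by
  obtain ⟨x, b⟩ := d
  cases b <;> simp only [mem_sided_true, mem_sided_false] at h ⊢ <;> grind

/-- Openness in the order topology of the sided points. -/
def IsSidedOpen (S : Set (ℝ × Bool)) : Prop :=
  (∀ x, (x, true) ∈ S → ∃ t, x < t ∧ sided x t ⊆ S) ∧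
    ∀ x, (x, false) ∈ S → ∃ s, s < x ∧ sided s x ⊆ S

theorem IsSidedOpen.exists_sided_subset {S : Set (ℝ × Bool)} (h : IsSidedOpen S)
    (hS : S.Nonempty) : ∃ s t, s < t ∧ sided s t ⊆ S := by
  obtain ⟨⟨x, b⟩, hx⟩ := hS
  cases b
  · obtain ⟨s, hs, h'⟩ := h.2 x hx
    exact ⟨s, x, hs, h'⟩
  · obtain ⟨t, ht, h'⟩ := h.1 x hx
    exact ⟨x, t, ht, h'⟩

theorem sided_bounds {s t a b : ℝ} (hst : s < t) (h : sided s t ⊆ sided a b) : a ≤ s ∧ t ≤ b :=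
  ⟨(h (mem_sided_true.2 ⟨le_rfl, hst⟩)).1, (h (mem_sided_false.2 ⟨hst, le_rfl⟩)).2.1⟩

/-! ### Expanding branches -/

/-- `g` is a continuous map on `[a, b]` which expands distances at least by the factor `r`. -/
structure IsExpandingBranch (r : ℝ) (g : ℝ → ℝ) (a b : ℝ) : Prop where
  continuousOn : ContinuousOn g (Icc a b)
  expand : ∀ x ∈ Icc a b, ∀ y ∈ Icc a b, x ≤ y → r * (y - x) ≤ g y - g x

namespace IsExpandingBranch

variable {r a b : ℝ} {g : ℝ → ℝ}

theorem mono (h : IsExpandingBranch r g a b) {a' b' : ℝ} (ha : a ≤ a') (hb : b' ≤ b) :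
    IsExpandingBranch r g a' b' :=
  ⟨h.continuousOn.mono (Icc_subset_Icc ha hb), fun x hx y hy =>
    h.expand x (Icc_subset_Icc ha hb hx) y (Icc_subset_Icc ha hb hy)⟩

theorem strictMonoOn (h : IsExpandingBranch r g a b) (hr : 1 < r) : StrictMonoOn g (Icc a b) := by
  intro x hx y hy hxy
  have := h.expand x hx y hy hxy.le
  nlinarith

theorem image_sided (h : IsExpandingBranch r g a b) (hr : 1 < r) (hab : a ≤ b) :
    (fun d : ℝ × Bool => (g d.1, d.2)) '' sided a b = sided (g a) (g b) := by
  have hm := h.strictMonoOn hr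
  have ha : a ∈ Icc a b := left_mem_Icc.2 hab
  have hb : b ∈ Icc a b := right_mem_Icc.2 hab
  ext ⟨y, e⟩
  constructor
  · rintro ⟨⟨x, e'⟩, hx, heq⟩
    obtain ⟨rfl, rfl⟩ := Prod.mk.inj heq
    have hxI : x ∈ Icc a b := ⟨hx.1, hx.2.1⟩
    exact ⟨hm.monotoneOn ha hxI hx.1, hm.monotoneOn hxI hb hx.2.1,
      fun he => hm hxI hb (hx.2.2.1 he), fun he => hm ha hxI (hx.2.2.2 he)⟩
  · intro hy
    obtain ⟨x, hx, rfl⟩ := intermediate_value_Icc hab h.continuousOn ⟨hy.1, hy.2.1⟩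
    exact ⟨(x, e), ⟨hx.1, hx.2, fun he => (hm.lt_iff_lt hx hb).1 (hy.2.2.1 he),
      fun he => (hm.lt_iff_lt ha hx).1 (hy.2.2.2 he)⟩, rfl⟩

/-- If the image of `d` is within `η` above the point `x₊`, and `x` is not below the image of the
branch, then `d` is within `η` above a preimage of `x₊`. -/
theorem exists_preimage_below (h : IsExpandingBranch r g a b) (hr : 1 < r) {η x : ℝ}
    {d : ℝ × Bool} (hd : d ∈ sided a b) (hx : (g d.1, d.2) ∈ sided x (x + η)) (hax : g a ≤ x)
    (hxb : x < g b) :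
    ∃ w, g w = x ∧ (w, true) ∈ sided a b ∧ d ∈ sided w (w + η) := by
  have hm := h.strictMonoOn hr
  obtain ⟨w, hw, rfl⟩ := intermediate_value_Icc (hd.1.trans hd.2.1) h.continuousOn ⟨hax, hxb.le⟩
  have hdI : d.1 ∈ Icc a b := ⟨hd.1, hd.2.1⟩
  have hwd : w ≤ d.1 := (hm.le_iff_le hw hdI).1 hx.1
  have hwb : w < b := (hm.lt_iff_lt hw (right_mem_Icc.2 (hd.1.trans hd.2.1))).1 hxb
  have hex := h.expand w hw d.1 hdI hwd
  refine ⟨w, rfl, mem_sided_true.2 ⟨hw.1, hwb⟩, hwd, ?_, fun hb => ?_, fun hb => ?_⟩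
  · have := hx.2.1
    dsimp only at this
    nlinarith
  · have := hx.2.2.1 hb
    dsimp only at this
    nlinarith
  · exact (hm.lt_iff_lt hw hdI).1 (hx.2.2.2 hb)

/-- The mirror image of `exists_preimage_below`. -/
theorem exists_preimage_above (h : IsExpandingBranch r g a b) (hr : 1 < r) {η x : ℝ}
    {d : ℝ × Bool} (hd : d ∈ sided a b) (hx : (g d.1, d.2) ∈ sided (x - η) x) (hax : g a < x)
    (hxb : x ≤ g b) :
    ∃ w, g w = x ∧ (w, false) ∈ sided a b ∧ d ∈ sided (w - η) w := by
  have hm := h.strictMonoOn hr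
  obtain ⟨w, hw, rfl⟩ := intermediate_value_Icc (hd.1.trans hd.2.1) h.continuousOn ⟨hax.le, hxb⟩
  have hdI : d.1 ∈ Icc a b := ⟨hd.1, hd.2.1⟩
  have hwd : d.1 ≤ w := (hm.le_iff_le hdI hw).1 hx.2.1
  have hwb : a < w := (hm.lt_iff_lt (left_mem_Icc.2 (hd.1.trans hd.2.1)) hw).1 hax
  have hex := h.expand d.1 hdI w hw hwd
  refine ⟨w, rfl, mem_sided_false.2 ⟨hwb, hw.2⟩, ?_, hwd, fun hb => ?_, fun hb => ?_⟩
  · have := hx.1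
    dsimp only at this
    nlinarith
  · exact (hm.lt_iff_lt hdI hw).1 (hx.2.2.1 hb)
  · have := hx.2.2.2 hb
    dsimp only at this
    nlinarith

end IsExpandingBranch

/-- A continuous function on `[u, v]` whose derivative is nonnegative off a finite set does not
decrease from `u` to `v`. -/
theorem le_of_deriv_nonneg_off_finset {g : ℝ → ℝ} (F : Finset ℝ) {u v : ℝ} (huv : u ≤ v)
    (hc : ContinuousOn g (Icc u v))
    (hd : ∀ x ∈ Ioo u v, x ∉ F → DifferentiableAt ℝ g x ∧ 0 ≤ deriv g x) : g u ≤ g v := by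
  classical
  induction hn : (F.filter (· ∈ Ioo u v)).card using Nat.strong_induction_on generalizing u v with
  | _ n ih =>
  by_cases hF : ∃ w ∈ F, w ∈ Ioo u v
  · obtain ⟨w, hwF, hw⟩ := hF
    have h₁ : (F.filter (· ∈ Ioo u w)).card < n := by
      rw [← hn]
      refine Finset.card_lt_card ((Finset.ssubset_iff_of_subset ?_).2 ⟨w, by simp [hwF, hw.1, hw.2],
        by simp⟩)
      exact Finset.monotone_filter_right F fun x _ hx => ⟨hx.1, hx.2.trans hw.2⟩
    have h₂ : (F.filter (· ∈ Ioo w v)).card < n := by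
      rw [← hn]
      refine Finset.card_lt_card ((Finset.ssubset_iff_of_subset ?_).2 ⟨w, by simp [hwF, hw.1, hw.2],
        by simp⟩)
      exact Finset.monotone_filter_right F fun x _ hx => ⟨hw.1.trans hx.1, hx.2⟩
    exact (ih _ h₁ hw.1.le (hc.mono (Icc_subset_Icc_right hw.2.le))
      (fun x hx => hd x ⟨hx.1, hx.2.trans hw.2⟩) rfl).trans
      (ih _ h₂ hw.2.le (hc.mono (Icc_subset_Icc_left hw.1.le))
      (fun x hx => hd x ⟨hw.1.trans hx.1, hx.2⟩) rfl)
  · have hF' : ∀ x ∈ Ioo u v, x ∉ F := fun x hx hxF => hF ⟨x, hxF, hx⟩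
    refine monotoneOn_of_deriv_nonneg (convex_Icc u v) hc ?_ ?_ (left_mem_Icc.2 huv)
      (right_mem_Icc.2 huv) huv
    · rw [interior_Icc]
      exact fun x hx => (hd x hx (hF' x hx)).1.differentiableWithinAt
    · rw [interior_Icc]
      exact fun x hx => (hd x hx (hF' x hx)).2

/-- The left branch of `f`, extended to `[0, c]` by its one-sided limit. -/
noncomputable def leftBranch (x : ℝ) : ℝ := if x = f.c then 1 else f.toFun x

/-- The right branch of `f`, extended to `[c, 1]` by its one-sided limit. -/
noncomputable def rightBranch (x : ℝ) : ℝ := if x = f.c then 0 else f.toFun x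

@[simp] theorem leftBranch_c : f.leftBranch f.c = 1 := if_pos rfl

@[simp] theorem rightBranch_c : f.rightBranch f.c = 0 := if_pos rfl

theorem leftBranch_of_ne {x : ℝ} (h : x ≠ f.c) : f.leftBranch x = f.toFun x := if_neg h

theorem rightBranch_of_ne {x : ℝ} (h : x ≠ f.c) : f.rightBranch x = f.toFun x := if_neg h

theorem leftBranch_mem {x : ℝ} (hx : x ∈ Icc (0 : ℝ) 1) : f.leftBranch x ∈ Icc (0 : ℝ) 1 := by
  unfold leftBranch
  split_ifs
  · simp
  · exact f.mapsTo hx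

theorem rightBranch_mem {x : ℝ} (hx : x ∈ Icc (0 : ℝ) 1) : f.rightBranch x ∈ Icc (0 : ℝ) 1 := by
  unfold rightBranch
  split_ifs
  · simp
  · exact f.mapsTo hx

theorem continuousOn_leftBranch : ContinuousOn f.leftBranch (Icc 0 f.c) := by
  have key := continuousOn_update_iff (f := f.toFun) (s := Icc 0 f.c) (x := f.c) (y := 1)
  have heq : f.leftBranch = Function.update f.toFun f.c 1 := by
    ext x; simp [leftBranch, Function.update_apply]
  rw [heq, key, Icc_sdiff_right]
  exact ⟨f.continuousOn_left, fun _ => f.tendsto_left.mono_left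
    (nhdsWithin_mono _ fun x hx => hx.2)⟩

theorem continuousOn_rightBranch : ContinuousOn f.rightBranch (Icc f.c 1) := by
  have key := continuousOn_update_iff (f := f.toFun) (s := Icc f.c 1) (x := f.c) (y := 0)
  have heq : f.rightBranch = Function.update f.toFun f.c 0 := by
    ext x; simp [rightBranch, Function.update_apply]
  rw [heq, key, Icc_sdiff_left]
  exact ⟨f.continuousOn_right, fun _ => f.tendsto_right.mono_left
    (nhdsWithin_mono _ fun x hx => hx.1)⟩

theorem exists_isExpandingBranch : ∃ r : ℝ, 1 < r ∧ IsExpandingBranch r f.leftBranch 0 f.c ∧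
    IsExpandingBranch r f.rightBranch f.c 1 := by
  obtain ⟨F, hF, -, r, hr, hd⟩ := f.expanding
  have hc := f.c_mem
  -- `x ↦ g x - r x` is nondecreasing for a branch `g`
  have key : ∀ (g : ℝ → ℝ) (a b : ℝ), 0 ≤ a → b ≤ 1 → f.c ∉ Ioo a b →
      (∀ x, x ≠ f.c → g x = f.toFun x) → ContinuousOn g (Icc a b) →
      IsExpandingBranch r g a b := by
    intro g a b ha hb hcab hg hgc
    refine ⟨hgc, fun x hx y hy hxy => ?_⟩
    have hdiff : ∀ z ∈ Ioo x y, z ∉ hF.toFinset →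
        ∃ m, r ≤ m ∧ HasDerivAt g m z := by
      intro z hz hzF
      have hzI : z ∈ Ioo a b := ⟨hx.1.trans_lt hz.1, hz.2.trans_le hy.2⟩
      have hz01 : z ∈ Ioo (0 : ℝ) 1 := ⟨ha.trans_lt hzI.1, hzI.2.trans_le hb⟩
      obtain ⟨h₁, h₂⟩ := hd z ⟨⟨hz01.1.le, hz01.2.le⟩, by simpa using hzF⟩
      have hnhds : Icc (0 : ℝ) 1 ∈ 𝓝 z := Icc_mem_nhds hz01.1 hz01.2
      rw [derivWithin_of_mem_nhds hnhds] at h₂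
      refine ⟨_, h₂, (h₁.differentiableAt hnhds).hasDerivAt.congr_of_eventuallyEq ?_⟩
      filter_upwards [Ioo_mem_nhds hzI.1 hzI.2] with w hw
      exact hg w fun h => hcab (h ▸ hw)
    have := le_of_deriv_nonneg_off_finset (g := fun z => g z - r * z) hF.toFinset hxy
      ((hgc.mono (Icc_subset_Icc hx.1 hy.2)).sub (by fun_prop)) fun z hz hzF => by
        obtain ⟨m, hm, hgm⟩ := hdiff z hz hzF
        have h := hgm.sub ((hasDerivAt_id z).const_mul r)
        have h' : HasDerivAt (fun z => g z - r * z) (m - r * 1) z := h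
        exact ⟨h'.differentiableAt, by rw [h'.deriv]; linarith⟩
    linarith
  exact ⟨r, hr, key _ _ _ le_rfl hc.2.le (by simp) (fun x => f.leftBranch_of_ne)
    f.continuousOn_leftBranch, key _ _ _ hc.1.le le_rfl (by simp)
    (fun x => f.rightBranch_of_ne) f.continuousOn_rightBranch⟩

/-! ### The map on sided points -/

open Classical in
/-- The map induced by `f` on sided points: `x₋` and `x₊` go to the one-sided limits of `f` at
`x`, with the same side. -/
noncomputable def sidedMap (d : ℝ × Bool) : ℝ × Bool :=
  (if d ∈ sided 0 f.c then f.leftBranch d.1 else f.rightBranch d.1, d.2)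

variable {f} in
theorem sidedMap_left {d : ℝ × Bool} (h : d ∈ sided 0 f.c) :
    f.sidedMap d = (f.leftBranch d.1, d.2) := by
  simp [sidedMap, h]

variable {f} in
theorem sidedMap_right {d : ℝ × Bool} (h : d ∈ sided f.c 1) :
    f.sidedMap d = (f.rightBranch d.1, d.2) := by
  simp [sidedMap, notMem_sided_of_mem h]

/-- On an interval that does not have `c` in its interior the map is one expanding branch. -/
theorem exists_branch {r : ℝ} (hl : IsExpandingBranch r f.leftBranch 0 f.c)
    (hr : IsExpandingBranch r f.rightBranch f.c 1) {s t : ℝ} (hs : 0 ≤ s) (ht : t ≤ 1)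
    (hc : t ≤ f.c ∨ f.c ≤ s) : ∃ g : ℝ → ℝ, IsExpandingBranch r g s t ∧
      (∀ d ∈ sided s t, f.sidedMap d = (g d.1, d.2)) ∧
      ∀ x ∈ Icc (0 : ℝ) 1, g x ∈ Icc (0 : ℝ) 1 := by
  rcases hc with hc | hc
  · exact ⟨f.leftBranch, hl.mono hs hc, fun d hd => sidedMap_left (sided_subset_sided hs hc hd),
      fun x => f.leftBranch_mem⟩
  · exact ⟨f.rightBranch, hr.mono hc ht, fun d hd => sidedMap_right (sided_subset_sided hc ht hd),
      fun x => f.rightBranch_mem⟩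

theorem exists_image_sidedMap {r : ℝ} (h1 : 1 < r) (hl : IsExpandingBranch r f.leftBranch 0 f.c)
    (hr : IsExpandingBranch r f.rightBranch f.c 1) {s t : ℝ} (hs : 0 ≤ s) (ht : t ≤ 1)
    (hst : s ≤ t) (hc : t ≤ f.c ∨ f.c ≤ s) :
    ∃ s' t', 0 ≤ s' ∧ t' ≤ 1 ∧ r * (t - s) ≤ t' - s' ∧
      f.sidedMap '' sided s t = sided s' t' := by
  obtain ⟨g, hg, hgm, hg01⟩ := f.exists_branch hl hr hs ht hc
  refine ⟨g s, g t, (hg01 s ⟨hs, hst.trans ht⟩).1, (hg01 t ⟨hs.trans hst, ht⟩).2,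
    hg.expand s ⟨le_rfl, hst⟩ t ⟨hst, le_rfl⟩ hst, ?_⟩
  rw [← hg.image_sided h1 hst]
  exact image_congr hgm

theorem image_sidedMap_left {r : ℝ} (h1 : 1 < r) (hl : IsExpandingBranch r f.leftBranch 0 f.c)
    {s : ℝ} (hs : 0 ≤ s) (hsc : s ≤ f.c) :
    f.sidedMap '' sided s f.c = sided (f.leftBranch s) 1 := by
  rw [← f.leftBranch_c, ← (hl.mono hs le_rfl).image_sided h1 hsc]
  exact image_congr fun d hd => sidedMap_left (sided_subset_sided hs le_rfl hd)

theorem image_sidedMap_right {r : ℝ} (h1 : 1 < r) (hr : IsExpandingBranch r f.rightBranch f.c 1)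
    {t : ℝ} (ht : t ≤ 1) (hct : f.c ≤ t) :
    f.sidedMap '' sided f.c t = sided 0 (f.rightBranch t) := by
  rw [← f.rightBranch_c, ← (hr.mono le_rfl ht).image_sided h1 hct]
  exact image_congr fun d hd => sidedMap_right (sided_subset_sided le_rfl ht hd)

theorem sidedMap_mem {d : ℝ × Bool} (hd : d ∈ sided 0 1) : f.sidedMap d ∈ sided 0 1 := by
  obtain ⟨r, h1, hl, hr⟩ := f.exists_isExpandingBranch
  have hc := f.c_mem
  rcases mem_sided_or hd f.c with h | h
  · have h' := (f.image_sidedMap_left h1 hl le_rfl hc.1.le).subset (mem_image_of_mem _ h)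
    exact sided_subset_sided (f.leftBranch_mem ⟨le_rfl, zero_le_one⟩).1 le_rfl h'
  · have h' := (f.image_sidedMap_right h1 hr le_rfl hc.2.le).subset (mem_image_of_mem _ h)
    exact sided_subset_sided le_rfl (f.rightBranch_mem ⟨zero_le_one, le_rfl⟩).2 h'

theorem iterate_sidedMap_mem {d : ℝ × Bool} (hd : d ∈ sided 0 1) (n : ℕ) :
    f.sidedMap^[n] d ∈ sided 0 1 := by
  induction n with
  | zero => exact hd
  | succ n ih => rw [Function.iterate_succ_apply']; exact f.sidedMap_mem ih

/-- Because all points are doubled, the map on sided points is open. -/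
theorem isSidedOpen_image {S : Set (ℝ × Bool)} (hS : IsSidedOpen S) (h01 : S ⊆ sided 0 1) :
    IsSidedOpen (f.sidedMap '' S) := by
  obtain ⟨r, h1, hl, hr⟩ := f.exists_isExpandingBranch
  have hc := f.c_mem
  constructor
  · rintro y ⟨⟨x, b⟩, hx, heq⟩
    obtain rfl : b = true := congrArg Prod.snd heq
    obtain ⟨t, hxt, ht⟩ := hS.1 x hx
    obtain ⟨t', hxt', ht', hct'⟩ : ∃ t', x < t' ∧ t' ≤ t ∧ (t' ≤ f.c ∨ f.c ≤ x) := by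
      by_cases h : x < f.c
      · exact ⟨min t f.c, lt_min hxt h, min_le_left _ _, Or.inl (min_le_right _ _)⟩
      · exact ⟨t, hxt, le_rfl, Or.inr (not_lt.1 h)⟩
    have hb := sided_bounds hxt (ht.trans h01)
    obtain ⟨g, hg, hgm, -⟩ := f.exists_branch hl hr hb.1 (ht'.trans hb.2) hct'
    have hy : g x = y := by
      have := hgm (x, true) (mem_sided_true.2 ⟨le_rfl, hxt'⟩)
      exact congrArg Prod.fst (this.symm.trans heq)
    refine ⟨g t', hy ▸ hg.strictMonoOn h1 ⟨le_rfl, hxt'.le⟩ ⟨hxt'.le, le_rfl⟩ hxt', ?_⟩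
    rw [← hy, ← hg.image_sided h1 hxt'.le, ← image_congr hgm]
    exact image_mono ((sided_subset_sided le_rfl ht').trans ht)
  · rintro y ⟨⟨x, b⟩, hx, heq⟩
    obtain rfl : b = false := congrArg Prod.snd heq
    obtain ⟨s, hsx, hs⟩ := hS.2 x hx
    obtain ⟨s', hsx', hs', hcs'⟩ : ∃ s', s' < x ∧ s ≤ s' ∧ (x ≤ f.c ∨ f.c ≤ s') := by
      by_cases h : f.c < x
      · exact ⟨max s f.c, max_lt hsx h, le_max_left _ _, Or.inr (le_max_right _ _)⟩
      · exact ⟨s, hsx, le_rfl, Or.inl (not_lt.1 h)⟩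
    have hb := sided_bounds hsx (hs.trans h01)
    obtain ⟨g, hg, hgm, -⟩ := f.exists_branch hl hr (hb.1.trans hs') hb.2 hcs'
    have hy : g x = y := by
      have := hgm (x, false) (mem_sided_false.2 ⟨hsx', le_rfl⟩)
      exact congrArg Prod.fst (this.symm.trans heq)
    refine ⟨g s', hy ▸ hg.strictMonoOn h1 ⟨le_rfl, hsx'.le⟩ ⟨hsx'.le, le_rfl⟩ hsx', ?_⟩
    rw [← hy, ← hg.image_sided h1 hsx'.le, ← image_congr hgm]
    exact image_mono ((sided_subset_sided hs' le_rfl).trans hs)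

theorem isSidedOpen_iterate_image {S : Set (ℝ × Bool)} (hS : IsSidedOpen S)
    (h01 : S ⊆ sided 0 1) (n : ℕ) : IsSidedOpen (f.sidedMap^[n] '' S) := by
  induction n with
  | zero => simpa using hS
  | succ n ih =>
    rw [Function.iterate_succ', image_comp]
    refine f.isSidedOpen_image ih ?_
    rintro _ ⟨d, hd, rfl⟩
    exact f.iterate_sidedMap_mem (h01 hd) n

/-! ### Forward orbits of open sets of sided points -/

/-- An interval is stretched by the factor `r` until some image has `c` in its interior. -/
theorem exists_sided_c_subset {r : ℝ} (h1 : 1 < r) (hl : IsExpandingBranch r f.leftBranch 0 f.c)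
    (hr : IsExpandingBranch r f.rightBranch f.c 1) {W : Set (ℝ × Bool)}
    (hW : ∀ d ∈ W, f.sidedMap d ∈ W) {s t : ℝ} (hst : s < t) (hs : 0 ≤ s) (ht : t ≤ 1)
    (h : sided s t ⊆ W) : ∃ δ > 0, 0 ≤ f.c - δ ∧ f.c + δ ≤ 1 ∧
      sided (f.c - δ) (f.c + δ) ⊆ W := by
  by_contra hcon
  have key : ∀ n : ℕ, ∃ s' t', 0 ≤ s' ∧ t' ≤ 1 ∧ r ^ n * (t - s) ≤ t' - s' ∧
      sided s' t' ⊆ W := by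
    intro n
    induction n with
    | zero => exact ⟨s, t, hs, ht, by simp, h⟩
    | succ n ih =>
      obtain ⟨s', t', hs', ht', hlen, hsub⟩ := ih
      have hst' : s' < t' := by
        have : 0 < r ^ n * (t - s) := mul_pos (pow_pos (by linarith) n) (by linarith)
        linarith
      have hc : t' ≤ f.c ∨ f.c ≤ s' := by
        by_contra! hc
        refine hcon ⟨min (f.c - s') (t' - f.c), lt_min (by linarith) (by linarith), ?_, ?_,
          (sided_subset_sided ?_ ?_).trans hsub⟩ <;>
        linarith [min_le_left (f.c - s') (t' - f.c), min_le_right (f.c - s') (t' - f.c)]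
      obtain ⟨s'', t'', h₁, h₂, h₃, h₄⟩ := f.exists_image_sidedMap h1 hl hr hs' ht' hst'.le hc
      refine ⟨s'', t'', h₁, h₂, le_trans ?_ h₃, ?_⟩
      · rw [pow_succ', mul_assoc]
        exact mul_le_mul_of_nonneg_left hlen (by linarith)
      · rw [← h₄]
        rintro _ ⟨d, hd, rfl⟩
        exact hW d (hsub hd)
  obtain ⟨n, hn⟩ := pow_unbounded_of_one_lt (1 / (t - s)) h1
  obtain ⟨s', t', hs', ht', hlen, -⟩ := key n
  rw [div_lt_iff₀ (by linarith)] at hn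
  linarith

/-- Transitivity on sided points, for open intervals of `[0, 1]`. -/
def IsSidedTransitive : Prop :=
  ∀ s t s' t' : ℝ, 0 ≤ s → s < t → t ≤ 1 → 0 ≤ s' → s' < t' → t' ≤ 1 →
    ∃ (d : ℝ × Bool) (n : ℕ), d.1 ∈ Ioo s t ∧ (f.sidedMap^[n] d).1 ∈ Ioo s' t'

/-- The complement of a forward invariant set `W` containing a neighbourhood of `c` is uniformly
discrete: the orbit of that neighbourhood consists of points lying in long intervals contained in
`W`, and by transitivity it visits the space between any two points missed by `W`. -/
theorem exists_separated {r : ℝ} (h1 : 1 < r) (hl : IsExpandingBranch r f.leftBranch 0 f.c)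
    (hr : IsExpandingBranch r f.rightBranch f.c 1) (htr : f.IsSidedTransitive)
    {W : Set (ℝ × Bool)} (hW : ∀ d ∈ W, f.sidedMap d ∈ W) {δ : ℝ} (hδ : 0 < δ)
    (hδ0 : 0 ≤ f.c - δ) (hδ1 : f.c + δ ≤ 1) (h : sided (f.c - δ) (f.c + δ) ⊆ W) :
    ∃ ε > 0, ∀ d ∈ sided 0 1 \ W, ∀ d' ∈ sided 0 1 \ W, d.1 < d'.1 → d.1 + ε ≤ d'.1 := by
  have hc := f.c_mem
  have hWl : sided (f.leftBranch (f.c - δ)) 1 ⊆ W := by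
    rw [← f.image_sidedMap_left h1 hl hδ0 (by linarith)]
    rintro _ ⟨d, hd, rfl⟩
    exact hW d (h (sided_subset_sided le_rfl (by linarith) hd))
  have hWr : sided 0 (f.rightBranch (f.c + δ)) ⊆ W := by
    rw [← f.image_sidedMap_right h1 hr hδ1 (by linarith)]
    rintro _ ⟨d, hd, rfl⟩
    exact hW d (h (sided_subset_sided (by linarith) le_rfl hd))
  have hl1 := hl.strictMonoOn h1 ⟨hδ0, by linarith⟩ ⟨hc.1.le, le_rfl⟩
    (show f.c - δ < f.c by linarith)
  have hr1 := hr.strictMonoOn h1 ⟨le_rfl, hc.2.le⟩ ⟨by linarith, hδ1⟩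
    (show f.c < f.c + δ by linarith)
  rw [leftBranch_c] at hl1
  rw [rightBranch_c] at hr1
  obtain ⟨ε, hε, hε1, hε2, hε3⟩ : ∃ ε > 0, ε ≤ 2 * δ ∧ ε ≤ 1 - f.leftBranch (f.c - δ) ∧
      ε ≤ f.rightBranch (f.c + δ) :=
    ⟨min (2 * δ) (min (1 - f.leftBranch (f.c - δ)) (f.rightBranch (f.c + δ))),
      lt_min (by linarith) (lt_min (by linarith) hr1), min_le_left _ _,
      (min_le_right _ _).trans (min_le_left _ _), (min_le_right _ _).trans (min_le_right _ _)⟩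
  have hb1 := (f.leftBranch_mem (x := f.c - δ) ⟨hδ0, by linarith⟩).1
  have hb2 := (f.rightBranch_mem (x := f.c + δ) ⟨by linarith, hδ1⟩).2
  have inv : ∀ d, (∃ s t, 0 ≤ s ∧ t ≤ 1 ∧ ε ≤ t - s ∧ sided s t ⊆ W ∧ d ∈ sided s t) →
      ∃ s t, 0 ≤ s ∧ t ≤ 1 ∧ ε ≤ t - s ∧ sided s t ⊆ W ∧ f.sidedMap d ∈ sided s t := by
    rintro d ⟨s, t, hs, ht, hlen, hsub, hd⟩
    have hsubW : ∀ {u v}, sided u v ⊆ sided s t → f.sidedMap '' sided u v ⊆ W := by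
      rintro u v huv _ ⟨d, hd, rfl⟩
      exact hW d (hsub (huv hd))
    by_cases hcst : t ≤ f.c ∨ f.c ≤ s
    · obtain ⟨s', t', h₁, h₂, h₃, h₄⟩ :=
        f.exists_image_sidedMap h1 hl hr hs ht (by linarith) hcst
      refine ⟨s', t', h₁, h₂, by nlinarith, h₄ ▸ hsubW Subset.rfl, h₄ ▸ mem_image_of_mem _ hd⟩
    · push Not at hcst
      -- the two halves of the interval are mapped to intervals ending in `1` and `0`; these may
      -- be short, but then they lie in the intervals at `1` and `0` that `W` contains anyway
      rcases mem_sided_or hd f.c with hd | hd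
      · have him := f.image_sidedMap_left h1 hl hs hcst.2.le
        have hmem : f.sidedMap d ∈ sided (f.leftBranch s) 1 := him ▸ mem_image_of_mem _ hd
        rcases le_total (f.leftBranch s) (f.leftBranch (f.c - δ)) with hle | hle
        · exact ⟨_, 1, (f.leftBranch_mem ⟨hs, by linarith⟩).1, le_rfl, by linarith,
            him ▸ hsubW (sided_subset_sided le_rfl hcst.1.le), hmem⟩
        · exact ⟨_, 1, hb1, le_rfl, hε2, hWl, sided_subset_sided hle le_rfl hmem⟩
      · have him := f.image_sidedMap_right h1 hr ht hcst.1.le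
        have hmem : f.sidedMap d ∈ sided 0 (f.rightBranch t) := him ▸ mem_image_of_mem _ hd
        rcases le_total (f.rightBranch (f.c + δ)) (f.rightBranch t) with hle | hle
        · exact ⟨0, _, le_rfl, (f.rightBranch_mem ⟨by linarith, ht⟩).2, by linarith,
            him ▸ hsubW (sided_subset_sided hcst.2.le le_rfl), hmem⟩
        · exact ⟨0, _, le_rfl, hb2, by linarith, hWr, sided_subset_sided le_rfl hle hmem⟩
  refine ⟨ε, hε, fun d hd d' hd' hlt => ?_⟩
  obtain ⟨u, n, hu, hn⟩ := htr (f.c - δ) (f.c + δ) d.1 d'.1 hδ0 (by linarith) hδ1 hd.1.1 hlt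
    hd'.1.2.1
  obtain ⟨s, t, -, -, hlen, hsub, hmem⟩ : ∃ s t, 0 ≤ s ∧ t ≤ 1 ∧ ε ≤ t - s ∧ sided s t ⊆ W ∧
      f.sidedMap^[n] u ∈ sided s t := by
    clear hn
    induction n with
    | zero => exact ⟨_, _, hδ0, hδ1, by linarith, h, mem_sided_of_lt hu.1 hu.2⟩
    | succ n ih => rw [Function.iterate_succ_apply']; exact inv _ ih
  have h₁ : d.1 ≤ s := by
    by_contra! hlt'
    exact hd.2 (hsub (mem_sided_of_lt hlt' (hn.1.trans_le hmem.2.1)))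
  have h₂ : t ≤ d'.1 := by
    by_contra! hlt'
    exact hd'.2 (hsub (mem_sided_of_lt (hmem.1.trans_lt hn.2) hlt'))
  linarith

/-- A uniformly separated set does not accumulate at `z` from the left. -/
theorem exists_gap_left {S : Set ℝ} {ε : ℝ} (hε : 0 < ε)
    (hS : ∀ x ∈ S, ∀ y ∈ S, x < y → x + ε ≤ y) (z : ℝ) :
    ∃ η > 0, ∀ x ∈ S, x < z → x + η < z := by
  by_cases h : ∃ x ∈ S, x < z ∧ z < x + ε
  · obtain ⟨x, hx, hxz, hzx⟩ := h
    refine ⟨(z - x) / 2, by linarith, fun y hy hyz => ?_⟩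
    rcases lt_or_ge x y with hxy | hxy
    · linarith [hS x hx y hy hxy]
    · linarith
  · push Not at h
    exact ⟨ε / 2, by linarith, fun x hx hxz => by linarith [h x hx hxz]⟩

/-- A uniformly separated set does not accumulate at `z` from the right. -/
theorem exists_gap_right {S : Set ℝ} {ε : ℝ} (hε : 0 < ε)
    (hS : ∀ x ∈ S, ∀ y ∈ S, x < y → x + ε ≤ y) (z : ℝ) :
    ∃ η > 0, ∀ x ∈ S, z < x → z + η < x := by
  obtain ⟨η, hη, h⟩ := exists_gap_left (S := Neg.neg '' S) hε (by
    rintro _ ⟨x, hx, rfl⟩ _ ⟨y, hy, rfl⟩ hxy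
    linarith [hS y hy x hx (by linarith)]) (-z)
  exact ⟨η, hη, fun x hx hzx => by linarith [h (-x) ⟨x, hx, rfl⟩ (by linarith)]⟩

/-- A forward invariant set containing a neighbourhood of `c` is everything. If not, small
one-sided neighbourhoods of the points it misses form an open set whose complement is forward
invariant, because `f` expands; this contradicts transitivity. -/
theorem sided_subset_of_forward_invariant {r : ℝ} (h1 : 1 < r)
    (hl : IsExpandingBranch r f.leftBranch 0 f.c) (hr : IsExpandingBranch r f.rightBranch f.c 1)
    (htr : f.IsSidedTransitive) {W : Set (ℝ × Bool)} (hW : ∀ d ∈ W, f.sidedMap d ∈ W) {δ : ℝ}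
    (hδ : 0 < δ) (hδ0 : 0 ≤ f.c - δ) (hδ1 : f.c + δ ≤ 1)
    (h : sided (f.c - δ) (f.c + δ) ⊆ W) : sided 0 1 ⊆ W := by
  by_contra hcon
  obtain ⟨⟨x₀, b₀⟩, hd₀, hd₀W⟩ := not_subset.1 hcon
  have hc := f.c_mem
  obtain ⟨ε, hε, hsep⟩ := f.exists_separated h1 hl hr htr hW hδ hδ0 hδ1 h
  have hsep' : ∀ x ∈ Prod.fst '' (sided 0 1 \ W), ∀ y ∈ Prod.fst '' (sided 0 1 \ W),
      x < y → x + ε ≤ y := by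
    rintro _ ⟨d, hd, rfl⟩ _ ⟨d', hd', rfl⟩
    exact hsep d hd d' hd'
  obtain ⟨η₁, hη₁, hgap₁⟩ := exists_gap_left hε hsep' (f.leftBranch 0)
  obtain ⟨η₂, hη₂, hgap₂⟩ := exists_gap_right hε hsep' (f.rightBranch 1)
  obtain ⟨η, hη, hηδ, hη1, hη2⟩ : ∃ η > 0, η ≤ δ / 2 ∧ η ≤ η₁ ∧ η ≤ η₂ :=
    ⟨min (δ / 2) (min η₁ η₂), lt_min (by linarith) (lt_min hη₁ hη₂), min_le_left _ _,
      (min_le_right _ _).trans (min_le_left _ _), (min_le_right _ _).trans (min_le_right _ _)⟩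
  let O : Set (ℝ × Bool) := {d | ∃ x, ((x, true) ∈ sided 0 1 \ W ∧ d ∈ sided x (x + η)) ∨
    ((x, false) ∈ sided 0 1 \ W ∧ d ∈ sided (x - η) x)}
  -- preimages of points of `O` lie in `O`
  have hback : ∀ d ∈ sided 0 1, f.sidedMap d ∈ O → d ∈ O := by
    rintro d hd ⟨x, ⟨hx, hdx⟩ | ⟨hx, hdx⟩⟩
    · have hx01 := mem_sided_true.1 hx.1
      rcases mem_sided_or hd f.c with hd | hd
      · rw [sidedMap_left hd] at hdx
        -- by the choice of `η`, the point `x₊` cannot lie below the image of the left branch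
        have hx0 : f.leftBranch 0 ≤ x := by
          by_contra! hlt
          have h₁ := hgap₁ x ⟨_, hx, rfl⟩ hlt
          have h₂ := hdx.2.1
          have h₃ := (hl.strictMonoOn h1).monotoneOn ⟨le_rfl, hc.1.le⟩ ⟨hd.1, hd.2.1⟩ hd.1
          dsimp only at h₂
          linarith
        obtain ⟨w, rfl, hw, hdw⟩ := hl.exists_preimage_below h1 hd hdx hx0 (by simpa using hx01.2)
        refine ⟨w, Or.inl ⟨⟨sided_subset_sided le_rfl hc.2.le hw, fun hwW => hx.2 ?_⟩, hdw⟩⟩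
        simpa [sidedMap_left hw] using hW _ hwW
      · rw [sidedMap_right hd] at hdx
        have hxb : x < f.rightBranch 1 := by
          have h₃ := (hr.strictMonoOn h1).monotoneOn ⟨hd.1, hd.2.1⟩ ⟨hc.2.le, le_rfl⟩ hd.2.1
          have h₁ := hdx.1
          dsimp only at h₁
          rcases hb : d.2 with _ | _
          · have := hdx.2.2.2 hb
            dsimp only at this
            linarith
          · have := hr.strictMonoOn h1 ⟨hd.1, hd.2.1⟩ ⟨hc.2.le, le_rfl⟩ (hd.2.2.1 hb)
            linarith
        obtain ⟨w, rfl, hw, hdw⟩ := hr.exists_preimage_below h1 hd hdx (by simpa using hx01.1) hxb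
        refine ⟨w, Or.inl ⟨⟨sided_subset_sided hc.1.le le_rfl hw, fun hwW => hx.2 ?_⟩, hdw⟩⟩
        simpa [sidedMap_right hw] using hW _ hwW
    · have hx01 := mem_sided_false.1 hx.1
      rcases mem_sided_or hd f.c with hd | hd
      · rw [sidedMap_left hd] at hdx
        have hxb : f.leftBranch 0 < x := by
          have h₃ := (hl.strictMonoOn h1).monotoneOn ⟨le_rfl, hc.1.le⟩ ⟨hd.1, hd.2.1⟩ hd.1
          have h₁ := hdx.2.1
          dsimp only at h₁
          rcases hb : d.2 with _ | _
          · have := hl.strictMonoOn h1 ⟨le_rfl, hc.1.le⟩ ⟨hd.1, hd.2.1⟩ (hd.2.2.2 hb)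
            linarith
          · have := hdx.2.2.1 hb
            dsimp only at this
            linarith
        obtain ⟨w, rfl, hw, hdw⟩ := hl.exists_preimage_above h1 hd hdx hxb (by simpa using hx01.2)
        refine ⟨w, Or.inr ⟨⟨sided_subset_sided le_rfl hc.2.le hw, fun hwW => hx.2 ?_⟩, hdw⟩⟩
        simpa [sidedMap_left hw] using hW _ hwW
      · rw [sidedMap_right hd] at hdx
        -- nor can `x₋` lie above the image of the right branch
        have hx0 : x ≤ f.rightBranch 1 := by
          by_contra! hlt
          have h₁ := hgap₂ x ⟨_, hx, rfl⟩ hlt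
          have h₂ := hdx.1
          have h₃ := (hr.strictMonoOn h1).monotoneOn ⟨hd.1, hd.2.1⟩ ⟨hc.2.le, le_rfl⟩ hd.2.1
          dsimp only at h₂
          linarith
        obtain ⟨w, rfl, hw, hdw⟩ := hr.exists_preimage_above h1 hd hdx (by simpa using hx01.1) hx0
        refine ⟨w, Or.inr ⟨⟨sided_subset_sided hc.1.le le_rfl hw, fun hwW => hx.2 ?_⟩, hdw⟩⟩
        simpa [sidedMap_right hw] using hW _ hwW
  have hOc : ∀ d : ℝ × Bool, d.1 ∈ Ioo (f.c - δ / 2) (f.c + δ / 2) → d ∉ O := by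
    rintro d hd ⟨x, ⟨hx, hdx⟩ | ⟨hx, hdx⟩⟩
    · refine hx.2 (h (mem_sided_of_lt ?_ ?_)) <;> dsimp only <;>
      linarith [hdx.1, hdx.2.1, hd.1, hd.2]
    · refine hx.2 (h (mem_sided_of_lt ?_ ?_)) <;> dsimp only <;>
      linarith [hdx.1, hdx.2.1, hd.1, hd.2]
  obtain ⟨s, t, hs, hst, ht, hO⟩ : ∃ s t, 0 ≤ s ∧ s < t ∧ t ≤ 1 ∧
      ∀ d : ℝ × Bool, d.1 ∈ Ioo s t → d ∈ O := by
    cases b₀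
    · have hx := mem_sided_false.1 hd₀
      exact ⟨max 0 (x₀ - η), x₀, le_max_left _ _, max_lt hx.1 (by linarith), hx.2, fun d hd =>
        ⟨x₀, Or.inr ⟨⟨hd₀, hd₀W⟩, mem_sided_of_lt ((le_max_right _ _).trans_lt hd.1) hd.2⟩⟩⟩
    · have hx := mem_sided_true.1 hd₀
      exact ⟨x₀, min 1 (x₀ + η), hx.1, lt_min hx.2 (by linarith), min_le_left _ _, fun d hd =>
        ⟨x₀, Or.inl ⟨⟨hd₀, hd₀W⟩, mem_sided_of_lt hd.1 (hd.2.trans_le (min_le_right _ _))⟩⟩⟩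
  obtain ⟨d, n, hd, hn⟩ := htr (f.c - δ / 2) (f.c + δ / 2) s t (by linarith) (by linarith)
    (by linarith) hs hst ht
  have hd01 : d ∈ sided 0 1 := mem_sided_of_lt (by linarith [hd.1]) (by linarith [hd.2])
  have hstay : ∀ m, f.sidedMap^[m] d ∉ O := by
    intro m
    induction m with
    | zero => exact hOc d hd
    | succ m ih =>
      rw [Function.iterate_succ_apply']
      exact fun hm => ih (hback _ (f.iterate_sidedMap_mem hd01 m) hm)
  exact hstay n (hO _ hn)

/-- Strong transitivity on sided points. The images of an open set are open, so that compactness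
of `[0, 1]` gives a finite number of them. -/
theorem exists_iterate_cover (htr : f.IsSidedTransitive) {V : Set (ℝ × Bool)}
    (hV : IsSidedOpen V) (hne : V.Nonempty) (h01 : V ⊆ sided 0 1) :
    ∃ k : ℕ, ∀ d ∈ sided 0 1, ∃ n ≤ k, d ∈ f.sidedMap^[n] '' V := by
  obtain ⟨r, h1, hl, hr⟩ := f.exists_isExpandingBranch
  obtain ⟨s, t, hst, hsub⟩ := hV.exists_sided_subset hne
  have hb := sided_bounds hst (hsub.trans h01)
  let W : Set (ℝ × Bool) := {d | ∃ n, d ∈ f.sidedMap^[n] '' V}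
  have hW : ∀ d ∈ W, f.sidedMap d ∈ W := by
    rintro _ ⟨n, u, hu, rfl⟩
    exact ⟨n + 1, u, hu, Function.iterate_succ_apply' _ _ _⟩
  obtain ⟨δ, hδ, hδ0, hδ1, hδW⟩ := f.exists_sided_c_subset h1 hl hr hW hst hb.1 hb.2
    (fun d hd => ⟨0, d, hsub hd, rfl⟩)
  have hall := f.sided_subset_of_forward_invariant h1 hl hr htr hW hδ hδ0 hδ1 hδW
  have hcov : ∃ k : ℕ, ∀ d ∈ sided 0 1, d.1 ∈ Icc (0 : ℝ) 1 →
      ∃ n ≤ k, d ∈ f.sidedMap^[n] '' V := by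
    refine isCompact_Icc.induction_on
      (p := fun S => ∃ k : ℕ, ∀ d ∈ sided 0 1, d.1 ∈ S → ∃ n ≤ k, d ∈ f.sidedMap^[n] '' V)
      ⟨0, fun _ _ h => h.elim⟩ ?_ ?_ ?_
    · rintro S T hST ⟨k, hk⟩
      exact ⟨k, fun d hd hdS => hk d hd (hST hdS)⟩
    · rintro S T ⟨k, hk⟩ ⟨l, hl⟩
      refine ⟨max k l, fun d hd hdS => ?_⟩
      rcases hdS with hdS | hdS
      · obtain ⟨n, hn, h⟩ := hk d hd hdS
        exact ⟨n, hn.trans (le_max_left _ _), h⟩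
      · obtain ⟨n, hn, h⟩ := hl d hd hdS
        exact ⟨n, hn.trans (le_max_right _ _), h⟩
    · intro x hx
      obtain ⟨t₁, ht₁, k₁, hk₁⟩ : ∃ t₁ > x, ∃ k₁, ∀ d ∈ sided x t₁,
          d ∈ sided 0 1 → d ∈ f.sidedMap^[k₁] '' V := by
        by_cases hx1 : x < 1
        · obtain ⟨k₁, hk₁⟩ := hall (mem_sided_true.2 ⟨hx.1, hx1⟩)
          obtain ⟨t₁, ht₁, h⟩ := (f.isSidedOpen_iterate_image hV h01 k₁).1 x hk₁
          exact ⟨t₁, ht₁, k₁, fun d hd _ => h hd⟩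
        · refine ⟨x + 1, by linarith, 0, fun d hd hd' => absurd hd' ?_⟩
          obtain rfl : x = 1 := le_antisymm hx.2 (not_lt.1 hx1)
          exact fun hd' => notMem_sided_of_mem hd hd'
      obtain ⟨s₁, hs₁, k₂, hk₂⟩ : ∃ s₁ < x, ∃ k₂, ∀ d ∈ sided s₁ x,
          d ∈ sided 0 1 → d ∈ f.sidedMap^[k₂] '' V := by
        by_cases hx0 : 0 < x
        · obtain ⟨k₂, hk₂⟩ := hall (mem_sided_false.2 ⟨hx0, hx.2⟩)
          obtain ⟨s₁, hs₁, h⟩ := (f.isSidedOpen_iterate_image hV h01 k₂).2 x hk₂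
          exact ⟨s₁, hs₁, k₂, fun d hd _ => h hd⟩
        · refine ⟨x - 1, by linarith, 0, fun d hd hd' => absurd hd ?_⟩
          obtain rfl : x = 0 := le_antisymm (not_lt.1 hx0) hx.1
          exact notMem_sided_of_mem hd'
      refine ⟨Ioo s₁ t₁, mem_nhdsWithin_of_mem_nhds (Ioo_mem_nhds hs₁ ht₁), max k₁ k₂,
        fun d hd hdI => ?_⟩
      rcases mem_sided_or (mem_sided_of_lt hdI.1 hdI.2) x with hd' | hd'
      · exact ⟨k₂, le_max_right _ _, hk₂ d hd' hd⟩
      · exact ⟨k₁, le_max_left _ _, hk₁ d hd' hd⟩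
  obtain ⟨k, hk⟩ := hcov
  exact ⟨k, fun d hd => hk d hd ⟨hd.1, hd.2.1⟩⟩

/-! ### From sided points to `𝕏` -/

/-- The projection of sided points to `𝕏`, which glues `x₋` and `x₊` unless `x` is doubled in `𝕏`.
Outside `[0, 1]` the first coordinate is clamped. -/
noncomputable def collapse (d : ℝ × Bool) : f.X :=
  f.ptOver (projIcc 0 1 zero_le_one d.1) (projIcc 0 1 zero_le_one d.1).2 d.2

variable {f}

theorem collapse_eq {d : ℝ × Bool} (h : d.1 ∈ Icc (0 : ℝ) 1) :
    f.collapse d = f.ptOver d.1 h d.2 := by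
  simp only [collapse, projIcc_of_mem zero_le_one h]

theorem proj_collapse {d : ℝ × Bool} (h : d.1 ∈ Icc (0 : ℝ) 1) : (f.collapse d).proj = d.1 := by
  rw [collapse_eq h]; rfl

open Classical in
theorem side_collapse {x : ℝ} {b : Bool} (h : x ∈ Icc (0 : ℝ) 1) :
    (f.collapse (x, b)).side = if x ∈ f.doubled then b else false := by
  rw [collapse_eq (d := (x, b)) h]; rfl

theorem X.lt_iff {p q : f.X} : p < q ↔ p.proj < q.proj ∨ p.proj = q.proj ∧ p.side < q.side :=
  Prod.Lex.lt_iff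

theorem X.ext {p q : f.X} (h₁ : p.proj = q.proj) (h₂ : p.side = q.side) : p = q :=
  Subtype.ext (Prod.ext h₁ h₂)

theorem X.mem_doubled {p : f.X} (h : p.side = true) : p.proj ∈ f.doubled := p.2.2 h

open Classical in
theorem ptOver_eq_of_notMem {y : ℝ} (hy : y ∈ Icc (0 : ℝ) 1) (h : y ∉ f.doubled) (s s' : Bool) :
    f.ptOver y hy s = f.ptOver y hy s' := by
  refine X.ext rfl ?_
  change (if y ∈ f.doubled then s else false) = if y ∈ f.doubled then s' else false
  rw [if_neg h, if_neg h]

theorem c_mem_doubled : f.c ∈ f.doubled := by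
  have hc := f.c_mem
  refine ⟨⟨⟨hc.1.le, hc.2.le⟩, 0, rfl⟩, ?_⟩
  rintro (h | h)
  · exact hc.1.ne' h
  · exact hc.2.ne h

theorem mem_Ioo_of_mem_doubled {x : ℝ} (h : x ∈ f.doubled) : x ∈ Ioo (0 : ℝ) 1 := by
  obtain ⟨⟨⟨h0, h1⟩, -⟩, hn⟩ := h
  simp only [mem_insert_iff, mem_singleton_iff, not_or] at hn
  exact ⟨lt_of_le_of_ne h0 (Ne.symm hn.1), lt_of_le_of_ne h1 hn.2⟩

theorem mem_doubled_of_apply {x : ℝ} (hx : x ∈ Ioo (0 : ℝ) 1) (h : f.toFun x ∈ f.doubled) :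
    x ∈ f.doubled := by
  obtain ⟨⟨-, n, hn⟩, -⟩ := h
  refine ⟨⟨⟨hx.1.le, hx.2.le⟩, n + 1, hn⟩, ?_⟩
  rintro (h | h)
  · exact hx.1.ne' h
  · exact hx.2.ne h

theorem exists_collapse_eq (p : f.X) : ∃ d ∈ sided 0 1, f.collapse d = p := by
  have hp := p.proj_mem
  rcases hs : p.side with _ | _
  · rcases hp.1.eq_or_lt with h0 | h0
    · refine ⟨(0, true), mem_sided_true.2 (by simp), X.ext ?_ ?_⟩
      · rw [proj_collapse (by simp)]; exact h0
      · rw [side_collapse (by simp), hs, if_neg fun h => (mem_Ioo_of_mem_doubled h).1.false]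
    · refine ⟨(p.proj, false), mem_sided_false.2 ⟨h0, hp.2⟩, X.ext (proj_collapse hp) ?_⟩
      rw [side_collapse hp, hs, ite_self]
  · have hd := X.mem_doubled hs
    refine ⟨(p.proj, true), mem_sided_true.2 ⟨hp.1, (mem_Ioo_of_mem_doubled hd).2⟩,
      X.ext (proj_collapse hp) ?_⟩
    rw [side_collapse hp, hs, if_pos hd]

theorem hat_collapse {d : ℝ × Bool} (hd : d ∈ sided 0 1) :
    f.hat (f.collapse d) = f.collapse (f.sidedMap d) := by
  obtain ⟨x, b⟩ := d
  have hx : x ∈ Icc (0 : ℝ) 1 := ⟨hd.1, hd.2.1⟩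
  have hc := f.c_mem
  have hp : (f.collapse (x, b)).proj = x := proj_collapse hx
  by_cases hxc : x = f.c
  · subst hxc
    have hs : (f.collapse (f.c, b)).side = b := by rw [side_collapse hx, if_pos c_mem_doubled]
    unfold hat
    rw [if_pos hp, hs]
    have h0 : (0 : ℝ) ∉ f.doubled := fun h => (mem_Ioo_of_mem_doubled h).1.false
    cases b
    · rw [sidedMap_left (mem_sided_false.2 ⟨hc.1, le_rfl⟩), leftBranch_c,
        collapse_eq (show (1 : ℝ) ∈ Icc (0 : ℝ) 1 by simp)]
      simp
    · rw [sidedMap_right (mem_sided_true.2 ⟨le_rfl, hc.2⟩), rightBranch_c,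
        collapse_eq (show (0 : ℝ) ∈ Icc (0 : ℝ) 1 by simp)]
      rw [if_pos rfl]
      exact ptOver_eq_of_notMem _ h0 _ _
  · have hmap : f.sidedMap (x, b) = (f.toFun x, b) := by
      simp [sidedMap, leftBranch_of_ne f hxc, rightBranch_of_ne f hxc]
    rw [hmap, collapse_eq (d := (f.toFun x, b)) (f.mapsTo hx)]
    unfold hat
    rw [if_neg (by rwa [hp])]
    by_cases hx0 : x = 0
    · subst hx0
      obtain rfl : b = true := by
        cases b
        · exact absurd (mem_sided_false.1 hd).1 (lt_irrefl _)
        · rfl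
      rw [if_pos hp]
      simp only [hp]
    · rw [if_neg (by rwa [hp])]
      simp only [hp]
      rw [side_collapse hx]
      by_cases hxd : x ∈ f.doubled
      · rw [if_pos hxd]
      · rw [if_neg hxd]
        by_cases hx1 : x = 1
        · subst hx1
          obtain rfl : b = false := by
            cases b
            · rfl
            · exact absurd (mem_sided_true.1 hd).2 (lt_irrefl _)
          rfl
        · have hfx : f.toFun x ∉ f.doubled := fun h => hxd (mem_doubled_of_apply
            ⟨lt_of_le_of_ne hx.1 (Ne.symm hx0), lt_of_le_of_ne hx.2 hx1⟩ h)
          exact ptOver_eq_of_notMem _ hfx _ _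

theorem iterate_hat_collapse {d : ℝ × Bool} (hd : d ∈ sided 0 1) (n : ℕ) :
    f.hat^[n] (f.collapse d) = f.collapse (f.sidedMap^[n] d) := by
  induction n with
  | zero => rfl
  | succ n ih =>
    rw [Function.iterate_succ_apply', Function.iterate_succ_apply', ih,
      hat_collapse (f.iterate_sidedMap_mem hd n)]

theorem collapse_true_lt_iff {x : ℝ} (hx : x ∈ Icc (0 : ℝ) 1) {p : f.X} :
    f.collapse (x, true) < p ↔ x < p.proj := by
  rw [X.lt_iff, proj_collapse hx, side_collapse hx]
  refine ⟨?_, Or.inl⟩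
  rintro (h | ⟨h, h'⟩)
  · exact h
  · have hs : p.side = true := by
      cases hps : p.side
      · rw [hps] at h'; exact absurd h' (by simp)
      · rfl
    have hd := X.mem_doubled hs
    rw [← h] at hd
    simp [hd, hs] at h'

theorem lt_collapse_false_iff {x : ℝ} (hx : x ∈ Icc (0 : ℝ) 1) {p : f.X} :
    p < f.collapse (x, false) ↔ p.proj < x := by
  rw [X.lt_iff, proj_collapse hx, side_collapse hx]
  refine ⟨?_, Or.inl⟩
  rintro (h | ⟨h, h'⟩)
  · exact h
  · exact absurd h' (by simp)

theorem IsTransitive.isSidedTransitive (hf : f.IsTransitive) : f.IsSidedTransitive := by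
  have key : ∀ s t : ℝ, 0 ≤ s → s < t → t ≤ 1 →
      IsOpen {p : f.X | p.proj ∈ Ioo s t} ∧ {p : f.X | p.proj ∈ Ioo s t}.Nonempty := by
    intro s t hs hst ht
    have heq : {p : f.X | p.proj ∈ Ioo s t} =
        Ioo (f.collapse (s, true)) (f.collapse (t, false)) := by
      ext p
      simp only [mem_ofPred_eq, mem_Ioo, collapse_true_lt_iff (x := s) ⟨hs, by linarith⟩,
        lt_collapse_false_iff (x := t) ⟨by linarith, ht⟩]
    refine ⟨heq ▸ isOpen_Ioo, f.collapse ((s + t) / 2, true), ?_⟩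
    rw [mem_ofPred_eq, proj_collapse (d := ((s + t) / 2, true))
      ⟨by dsimp; linarith, by dsimp; linarith⟩]
    exact ⟨by dsimp; linarith, by dsimp; linarith⟩
  intro s t s' t' hs hst ht hs' hst' ht'
  obtain ⟨n, -, q, ⟨p, hp, rfl⟩, hq⟩ := hf _ _ (key s t hs hst ht).1 (key s t hs hst ht).2
    (key s' t' hs' hst' ht').1 (key s' t' hs' hst' ht').2
  obtain ⟨d, hd, rfl⟩ := exists_collapse_eq p
  have hn := f.iterate_sidedMap_mem hd n
  rw [mem_ofPred_eq, proj_collapse ⟨hd.1, hd.2.1⟩] at hp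
  rw [mem_ofPred_eq, iterate_hat_collapse hd, proj_collapse ⟨hn.1, hn.2.1⟩] at hq
  exact ⟨d, n, hp, hq⟩

theorem isSidedOpen_preimage_collapse {U : Set f.X} (hU : IsOpen U) :
    IsSidedOpen (sided 0 1 ∩ f.collapse ⁻¹' U) := by
  constructor
  · rintro x ⟨hx, hxU⟩
    obtain ⟨hx0, hx1⟩ := mem_sided_true.1 hx
    have hxI : x ∈ Icc (0 : ℝ) 1 := ⟨hx0, hx1.le⟩
    obtain ⟨l, hl, hlU⟩ := exists_Ico_subset_of_mem_nhds (hU.mem_nhds hxU)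
      ⟨f.collapse (1, false), (collapse_true_lt_iff hxI).2
        (by rw [proj_collapse (by simp)]; exact hx1)⟩
    rw [collapse_true_lt_iff hxI] at hl
    -- the midpoint, because the lower point over `l.proj` may be `l` itself
    refine ⟨(x + l.proj) / 2, by linarith, fun d hd => ?_⟩
    have hl1 := l.proj_mem.2
    have hd01 : d ∈ sided 0 1 := sided_subset_sided hx0 (by linarith) hd
    have hp := proj_collapse (f := f) ⟨hd01.1, hd01.2.1⟩
    refine ⟨hd01, hlU ⟨not_lt.1 fun hlt => ?_, X.lt_iff.2 (Or.inl ?_)⟩⟩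
    · rw [X.lt_iff, hp, proj_collapse hxI] at hlt
      rcases hlt with hlt | ⟨heq, hlt⟩
      · exact absurd hd.1 (not_le.2 hlt)
      · obtain ⟨y, b⟩ := d
        obtain rfl : y = x := heq
        cases b
        · exact absurd (mem_sided_false.1 hd).1 (lt_irrefl _)
        · exact absurd hlt (lt_irrefl _)
    · rw [hp]
      linarith [hd.2.1]
  · rintro x ⟨hx, hxU⟩
    obtain ⟨hx0, hx1⟩ := mem_sided_false.1 hx
    have hxI : x ∈ Icc (0 : ℝ) 1 := ⟨hx0.le, hx1⟩
    obtain ⟨l, hl, hlU⟩ := exists_Ioc_subset_of_mem_nhds (hU.mem_nhds hxU)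
      ⟨f.collapse (0, true), (lt_collapse_false_iff hxI).2
        (by rw [proj_collapse (by simp)]; exact hx0)⟩
    rw [lt_collapse_false_iff hxI] at hl
    refine ⟨(x + l.proj) / 2, by linarith, fun d hd => ?_⟩
    have hl1 := l.proj_mem.1
    have hd01 : d ∈ sided 0 1 := sided_subset_sided (by linarith) hx1 hd
    have hp := proj_collapse (f := f) ⟨hd01.1, hd01.2.1⟩
    refine ⟨hd01, hlU ⟨X.lt_iff.2 (Or.inl ?_), not_lt.1 fun hlt => ?_⟩⟩
    · rw [hp]
      linarith [hd.1]
    · rw [X.lt_iff, hp, proj_collapse hxI] at hlt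
      rcases hlt with hlt | ⟨heq, hlt⟩
      · exact absurd hd.2.1 (not_le.2 hlt)
      · obtain ⟨y, b⟩ := d
        obtain rfl : x = y := heq
        cases b
        · exact absurd hlt (lt_irrefl _)
        · exact absurd (mem_sided_true.1 hd).2 (lt_irrefl _)

end ExpandingLorenzMap

theorem mainTheorem1 (f : ExpandingLorenzMap) (hf : f.IsTransitive)
    (U : Set f.X) (hU : IsOpen U) (hne : U.Nonempty) :
    ∃ k : ℕ, (⋃ i ∈ Set.Iic k, f.hat^[i] '' U) = Set.univ := by
  have hV : (ExpandingLorenzMap.sided 0 1 ∩ f.collapse ⁻¹' U).Nonempty := by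
    obtain ⟨p, hp⟩ := hne
    obtain ⟨d, hd, rfl⟩ := ExpandingLorenzMap.exists_collapse_eq p
    exact ⟨d, hd, hp⟩
  obtain ⟨k, hk⟩ := f.exists_iterate_cover hf.isSidedTransitive
    (ExpandingLorenzMap.isSidedOpen_preimage_collapse hU) hV inter_subset_left
  refine ⟨k, eq_univ_of_forall fun p => ?_⟩
  obtain ⟨d, hd, rfl⟩ := ExpandingLorenzMap.exists_collapse_eq p
  obtain ⟨n, hn, u, ⟨hu, huU⟩, rfl⟩ := hk d hd
  exact mem_biUnion (show n ∈ Iic k from hn) ⟨f.collapse u, huU,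
    ExpandingLorenzMap.iterate_hat_collapse hu n⟩
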